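/- Let $H(\mathbb C)$ be the algebra of entire functions with the compact-open topology and let $D$ be the operator of complex differentiation on it. Let $a$ and $z_n$ $(n\in\mathbb N)$ be non-zero complex scalars satisfying (i) $\sum_{n=1}^\infty \frac{1}{|z_n|}<\infty$ and (ii) $\sum_{n=1}^\infty \frac{1}{z_n^2}\neq 0$, and let $\Phi(z)=e^{az}\prod_{n=1}^\infty\left(1-\frac{z}{z_n}\right)$. Then $\Phi$ is entire, the operator $\Phi(D)f=\sum_{n=0}^\infty \frac{\Phi^{(n)}(0)}{n!}D^nf$ is a well-defined continuous linear operator on $H(\mathbb C)$, and $\Phi(D)$ has a hypercyclic algebra, that is, there is a non-zero (not necessarily unital) subalgebra $A$ of $H(\mathbb C)$ such that for every non-zero $f\in A$ the orbit $\{\Phi(D)^nf : n\ge 0\}$ is dense in $H(\mathbb C)$. -/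

import Mathlib

/-- The algebra `H(ℂ)` of entire functions, as a subalgebra of the algebra `C(ℂ, ℂ)` of
continuous functions. It carries the subspace topology of the compact-open topology on
`C(ℂ, ℂ)`, i.e. the topology of locally uniform convergence. -/
def entireFunctions : Subalgebra ℂ C(ℂ, ℂ) where
  carrier := {f | Differentiable ℂ f}
  mul_mem' hf hg := Differentiable.mul hf hg
  add_mem' hf hg := Differentiable.add hf hg
  algebraMap_mem' c := differentiable_const c

/-- Complex differentiation `D : H(ℂ) → H(ℂ)`, `f ↦ f'`. -/
noncomputable def entireDeriv : entireFunctions →ₗ[ℂ] entireFunctions where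
  toFun f := ⟨⟨deriv f.1, (Differentiable.deriv f.2).continuous⟩, Differentiable.deriv f.2⟩
  map_add' f g := by
    ext z
    exact deriv_add (f.2 z) (g.2 z)
  map_smul' c f := by
    ext z
    exact deriv_const_smul c (f.2 z)

/-- `T` is the operator `Φ(D)` on `H(ℂ)` with symbol `Φ`: writing `Φ(z) = ∑ aₙ zⁿ` for the Taylor
expansion of `Φ` at `0`, the series `∑ aₙ Dⁿ f` converges to `T f` in `H(ℂ)`, for every `f`.
Since `H(ℂ)` is Hausdorff, there is at most one such `T`. -/
def IsSymbolOperator (Φ : ℂ → ℂ) (T : entireFunctions →L[ℂ] entireFunctions) : Prop :=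
  ∀ f : entireFunctions,
    HasSum (fun n : ℕ => (iteratedDeriv n Φ 0 / (n.factorial : ℂ)) • (entireDeriv ^ n) f) (T f)

/-- A vector is hypercyclic for `T` if its orbit `{Tⁿ x : n ≥ 0}` is dense. -/
def IsHypercyclicVector {X : Type*} [TopologicalSpace X] (T : X → X) (x : X) : Prop :=
  Dense (Set.range fun n : ℕ => T^[n] x)

/-- `T` has a hypercyclic algebra: there is a nonzero subalgebra of `X` (not required to contain
the unit) all of whose nonzero elements are hypercyclic vectors for `T`. -/
def HasHypercyclicAlgebra {X : Type*} [Semiring X] [Algebra ℂ X] [TopologicalSpace X]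
    (T : X →L[ℂ] X) : Prop :=
  ∃ A : NonUnitalSubalgebra ℂ X,
    (∃ x ∈ A, x ≠ 0) ∧ ∀ x ∈ A, x ≠ 0 → IsHypercyclicVector T x

open Filter Topology Set

/-! The proof rests on the exponentials `e_θ(w) = exp (θ w)`: they satisfy `e_θ e_θ' = e_{θ+θ'}` and
`Φ(D) e_θ = Φ(θ) e_θ`, so the action of `Φ(D)^q` on powers of their combinations is explicit. Those
with small frequencies on any fixed ray span a dense subspace. By Baire category
(`hasHypercyclicAlgebra_of_steering`) it suffices, for each `m`, to find `f` near a given function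
and `q` such that `Φ(D)^q` sends `f ^ m` near a given target and all lower powers near `0`. The
polynomials without constant term in a generic `f` then form the algebra, since the leading term
decides where the orbit goes. Such an `f` is `∑ α_i e_{t_i v'} + ∑ r_j μ_j^q e_{s_j v}`
(`IsSymbolOperator.exists_steering`). Here `|Φ| < 1` near `0` on the ray of `v'`, `|Φ| > 1` on that
of `v`, and `μ_j^m Φ(m s_j v) = 1`. In `f ^ m` the pure powers `e_{s_j v}^m` survive with multiplier
exactly `1`; every other product has a multiplier of modulus `< 1` and dies. For products involving
only the `s_j` this is strict Jensen for `s ↦ log |Φ(s v)|`; the small `t_i` are a perturbation.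
Both rays exist because `(log Φ)''(0) = -∑ 1 / z_n² ≠ 0`: a direction can be chosen making the real
part of `log Φ`, or of `-log Φ`, strictly convex with nonnegative initial slope. -/

/-! ### Topology of `H(ℂ)`. -/

/-- Convergence in `H(ℂ)` is uniform convergence on closed balls. -/
theorem tendsto_entireFunctions_iff {ι : Type*} {l : Filter ι} {F : ι → entireFunctions}
    {f : entireFunctions} :
    Tendsto F l (𝓝 f) ↔ ∀ R ε : ℝ, 0 < ε →
      ∀ᶠ i in l, ∀ z : ℂ, ‖z‖ ≤ R → ‖(F i).1 z - f.1 z‖ < ε := by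
  rw [tendsto_subtype_rng, ContinuousMap.tendsto_iff_forall_isCompact_tendstoUniformlyOn]
  constructor
  · intro h R ε hε
    have := Metric.tendstoUniformlyOn_iff.1 (h _ (isCompact_closedBall (0 : ℂ) R)) ε hε
    filter_upwards [this] with i hi z hz
    rw [← dist_eq_norm, dist_comm]
    exact hi z (by simpa using hz)
  · intro h K hK
    obtain ⟨R, hR⟩ := hK.isBounded.subset_closedBall (0 : ℂ)
    rw [Metric.tendstoUniformlyOn_iff]
    intro ε hε
    filter_upwards [h R ε hε] with i hi z hz
    rw [dist_comm, dist_eq_norm]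
    exact hi z (by simpa using hR hz)

/-- Weierstrass: locally uniform limits of holomorphic functions are holomorphic. This gives
completeness, hence the Baire property. -/
theorem isClosed_entireFunctions : IsClosed (entireFunctions : Set C(ℂ, ℂ)) := by
  refine isClosed_of_closure_subset fun f hf => ?_
  rw [mem_closure_iff_comap_neBot] at hf
  have h : Tendsto (fun g : (entireFunctions : Set C(ℂ, ℂ)) => g.1)
      (comap (↑) (𝓝 f)) (𝓝 f) := tendsto_comap
  rw [ContinuousMap.tendsto_iff_tendstoLocallyUniformly,
    ← tendstoLocallyUniformlyOn_univ] at h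
  have := h.differentiableOn (Eventually.of_forall fun g => Differentiable.differentiableOn g.2)
    isOpen_univ
  exact differentiableOn_univ.1 this

instance entireFunctions.instBaireSpace : BaireSpace entireFunctions := by
  have : CompleteSpace entireFunctions := isClosed_entireFunctions.completeSpace_coe
  have : (uniformity entireFunctions).IsCountablyGenerated :=
    inferInstanceAs (uniformity (entireFunctions : Set C(ℂ, ℂ))).IsCountablyGenerated
  infer_instance

instance entireFunctions.instIsTopologicalRing : IsTopologicalRing entireFunctions where
  continuous_neg := (continuous_subtype_val.neg).subtype_mk _

instance entireFunctions.instSecondCountableTopology :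
    SecondCountableTopology entireFunctions :=
  inferInstanceAs (SecondCountableTopology (entireFunctions : Set C(ℂ, ℂ)))

instance entireFunctions.instNontrivial : Nontrivial entireFunctions := by
  refine ⟨0, 1, fun h => ?_⟩
  have : (0 : entireFunctions).1 0 = (1 : entireFunctions).1 0 := by rw [h]
  simp at this

instance entireFunctions.instIsTopologicalAddGroup : IsTopologicalAddGroup entireFunctions where
  continuous_add := continuous_add
  continuous_neg := (continuous_subtype_val.neg).subtype_mk _

/-! ### Power series in `D`. -/

theorem entireDeriv_pow_apply (n : ℕ) (f : entireFunctions) (w : ℂ) :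
    ((entireDeriv ^ n) f).1 w = iteratedDeriv n f.1 w := by
  induction n generalizing w with
  | zero => simp
  | succ n ih =>
    rw [pow_succ', iteratedDeriv_succ, ← funext ih]
    rfl

theorem entireFunctions.exists_norm_le_of_norm_le (f : entireFunctions) (R : ℝ) :
    ∃ M, 0 ≤ M ∧ ∀ w : ℂ, ‖w‖ ≤ R → ‖f.1 w‖ ≤ M := by
  obtain ⟨M, hM⟩ := (isCompact_closedBall (0 : ℂ) R).exists_bound_of_continuousOn
    f.1.continuous.continuousOn
  refine ⟨max M 0, le_max_right _ _, fun w hw => (hM w ?_).trans (le_max_left _ _)⟩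
  simpa using hw

/-- Cauchy's estimate on a circle of radius `2 * K`: the factorials cancel and `K ^ n / (2 * K) ^ n`
leaves a geometric majorant, uniform on the ball of radius `R`. -/
theorem norm_smul_iteratedDeriv_le {a : ℕ → ℂ} {K : ℝ} (hK : 0 < K)
    (ha : ∀ n, ‖a n‖ ≤ K ^ n / n.factorial) (f : entireFunctions) {R M : ℝ}
    (hf : ∀ w : ℂ, ‖w‖ ≤ R + 2 * K → ‖f.1 w‖ ≤ M) (n : ℕ) {w : ℂ} (hw : ‖w‖ ≤ R) :
    ‖a n * iteratedDeriv n f.1 w‖ ≤ M * (1 / 2) ^ n := by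
  have h1 : ‖iteratedDeriv n f.1 w‖ ≤ n.factorial * M / (2 * K) ^ n := by
    refine Complex.norm_iteratedDeriv_le_of_forall_mem_sphere_norm_le n (by positivity)
      (Differentiable.diffContOnCl f.2) fun x hx => hf x ?_
    have : ‖x - w‖ = 2 * K := by simpa [dist_eq_norm] using hx
    calc ‖x‖ = ‖w + (x - w)‖ := by ring_nf
      _ ≤ ‖w‖ + ‖x - w‖ := norm_add_le _ _
      _ ≤ _ := by linarith
  rw [norm_mul]
  calc _ ≤ K ^ n / n.factorial * (n.factorial * M / (2 * K) ^ n) :=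
        mul_le_mul (ha n) h1 (norm_nonneg _) (by positivity)
    _ = _ := by
        have : (n.factorial : ℝ) ≠ 0 := by positivity
        rw [mul_pow, one_div, inv_pow]
        field_simp

/-- A power series `∑ aₙ Dⁿ` with coefficients of exponential type defines a continuous linear
operator on `H(ℂ)`. -/
theorem exists_hasSum_smul_entireDeriv_pow {a : ℕ → ℂ} {K : ℝ} (hK : 0 < K)
    (ha : ∀ n, ‖a n‖ ≤ K ^ n / n.factorial) :
    ∃ T : entireFunctions →L[ℂ] entireFunctions,
      ∀ f, HasSum (fun n => a n • (entireDeriv ^ n) f) (T f) := by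
  have hgeo : Summable fun n : ℕ => ((1 : ℝ) / 2) ^ n := summable_geometric_two
  have hsm : ∀ (f : entireFunctions) (w : ℂ), Summable fun n => a n * iteratedDeriv n f.1 w := by
    intro f w
    obtain ⟨M, -, hM⟩ := entireFunctions.exists_norm_le_of_norm_le f (‖w‖ + 2 * K)
    exact Summable.of_norm_bounded (hgeo.mul_left M)
      fun n => norm_smul_iteratedDeriv_le hK ha f hM n le_rfl
  have hdiff : ∀ f : entireFunctions,
      Differentiable ℂ fun w => ∑' n, a n * iteratedDeriv n f.1 w := by
    intro f w
    obtain ⟨M, -, hM⟩ := entireFunctions.exists_norm_le_of_norm_le f ((‖w‖ + 1) + 2 * K)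
    have hd : DifferentiableOn ℂ (fun w => ∑' n, a n * iteratedDeriv n f.1 w)
        (Metric.ball 0 (‖w‖ + 1)) := by
      refine Complex.differentiableOn_tsum_of_summable_norm (hgeo.mul_left M) (fun n => ?_)
        Metric.isOpen_ball fun n x hx =>
          norm_smul_iteratedDeriv_le hK ha f hM n (by simpa using (Metric.mem_ball.1 hx).le)
      have : (fun w => a n * iteratedDeriv n f.1 w) =
          fun w => a n * ((entireDeriv ^ n) f).1 w := by
        ext w; rw [entireDeriv_pow_apply]
      rw [this]
      exact (Differentiable.const_mul ((entireDeriv ^ n) f).2 _).differentiableOn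
    exact hd.differentiableAt (Metric.isOpen_ball.mem_nhds (by simp))
  let L : entireFunctions →ₗ[ℂ] entireFunctions :=
    { toFun := fun f => ⟨⟨_, (hdiff f).continuous⟩, hdiff f⟩
      map_add' := by
        intro f g
        ext w
        change ∑' n, a n * iteratedDeriv n (f + g).1 w =
          (∑' n, a n * iteratedDeriv n f.1 w) + ∑' n, a n * iteratedDeriv n g.1 w
        rw [← (hsm f w).tsum_add (hsm g w)]
        refine tsum_congr fun n => ?_
        simp only [← entireDeriv_pow_apply, map_add]
        exact mul_add _ _ _
      map_smul' := by
        intro c f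
        ext w
        change ∑' n, a n * iteratedDeriv n (c • f).1 w =
          c * (∑' n, a n * iteratedDeriv n f.1 w)
        rw [← tsum_mul_left]
        refine tsum_congr fun n => ?_
        simp only [← entireDeriv_pow_apply, map_smul]
        exact mul_left_comm _ _ _ }
  have hL : ∀ f w, (L f).1 w = ∑' n, a n * iteratedDeriv n f.1 w := fun _ _ => rfl
  have hbound : ∀ (f : entireFunctions) (R M : ℝ),
      (∀ w : ℂ, ‖w‖ ≤ R + 2 * K → ‖f.1 w‖ ≤ M) → ∀ w : ℂ, ‖w‖ ≤ R → ‖(L f).1 w‖ ≤ 2 * M := by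
    intro f R M hM w hw
    rw [hL]
    refine tsum_of_norm_bounded (g := fun n => M * (1 / 2) ^ n) ?_
      fun n => norm_smul_iteratedDeriv_le hK ha f hM n hw
    rw [mul_comm]
    exact hasSum_geometric_two.mul_left M
  have hcont : Continuous L := by
    refine continuous_of_continuousAt_zero L.toAddMonoidHom ?_
    rw [ContinuousAt, map_zero, tendsto_entireFunctions_iff]
    intro R ε hε
    have h := (tendsto_entireFunctions_iff (F := id)).1
      (tendsto_id (x := 𝓝 (0 : entireFunctions))) (R + 2 * K) (ε / 4) (by positivity)
    filter_upwards [h] with f hf w hw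
    have := hbound f R (ε / 4) (fun x hx => by simpa using (hf x hx).le) w hw
    change ‖(L f).1 w - 0‖ < ε
    rw [sub_zero]
    linarith
  refine ⟨⟨L, hcont⟩, fun f => ?_⟩
  rw [HasSum, tendsto_entireFunctions_iff]
  intro R ε hε
  obtain ⟨M, -, hM⟩ := entireFunctions.exists_norm_le_of_norm_le f (R + 2 * K)
  have hu := tendstoUniformlyOn_tsum (f := fun n w => a n * iteratedDeriv n f.1 w)
    (s := Metric.closedBall 0 R) (hgeo.mul_left M)
    fun n x hx => norm_smul_iteratedDeriv_le hK ha f hM n (by simpa using hx)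
  filter_upwards [Metric.tendstoUniformlyOn_iff.1 hu ε hε] with s hs w hw
  have := hs w (by simpa using hw)
  rw [dist_comm, dist_eq_norm] at this
  have h1 : (∑ n ∈ s, a n • (entireDeriv ^ n) f).1 w =
      ∑ n ∈ s, a n * ((entireDeriv ^ n) f).1 w := by
    rw [AddSubmonoidClass.coe_finsetSum, ContinuousMap.sum_apply]
    rfl
  change ‖_ - (L f).1 w‖ < ε
  rw [h1, hL]
  simpa only [entireDeriv_pow_apply] using this

/-! ### Exponentials as eigenvectors; symbols of exponential type. -/

/-- The exponential `w ↦ exp (θ w)` as an element of `H(ℂ)`. -/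
noncomputable def entireExp (θ : ℂ) : entireFunctions :=
  ⟨⟨fun w => Complex.exp (θ * w), by fun_prop⟩, by
    change Differentiable ℂ fun w => Complex.exp (θ * w)
    fun_prop⟩

theorem entireExp_zero : entireExp 0 = 1 := by
  ext w
  simp [entireExp]

theorem entireExp_add (θ θ' : ℂ) : entireExp (θ + θ') = entireExp θ * entireExp θ' := by
  ext w
  simp [entireExp, add_mul, Complex.exp_add]

theorem prod_entireExp {ι : Type*} (s : Finset ι) (θ : ι → ℂ) :
    ∏ i ∈ s, entireExp (θ i) = entireExp (∑ i ∈ s, θ i) := by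
  classical
  induction s using Finset.induction_on with
  | empty => simp [entireExp_zero]
  | insert i s hi ih => rw [Finset.prod_insert hi, Finset.sum_insert hi, ih, entireExp_add]

theorem entireDeriv_entireExp (θ : ℂ) : entireDeriv (entireExp θ) = θ • entireExp θ := by
  ext w
  change deriv (fun w => Complex.exp (θ * w)) w = θ * Complex.exp (θ * w)
  have : HasDerivAt (fun w => Complex.exp (θ * w)) (Complex.exp (θ * w) * (θ * 1)) w :=
    ((hasDerivAt_id w).const_mul θ).cexp
  rw [this.deriv]
  ring

theorem entireDeriv_pow_entireExp (θ : ℂ) (n : ℕ) :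
    (entireDeriv ^ n) (entireExp θ) = θ ^ n • entireExp θ := by
  induction n with
  | zero => simp
  | succ n ih =>
    rw [pow_succ', Module.End.mul_apply, ih, map_smul, entireDeriv_entireExp, smul_smul, pow_succ]

theorem IsSymbolOperator.apply_entireExp {Φ : ℂ → ℂ} {T : entireFunctions →L[ℂ] entireFunctions}
    (hT : IsSymbolOperator Φ T) (hΦ : Differentiable ℂ Φ) (θ : ℂ) :
    T (entireExp θ) = Φ θ • entireExp θ := by
  refine (hT (entireExp θ)).unique ?_
  have h := Complex.hasSum_taylorSeries_of_entire hΦ 0 θ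
  have h2 := h.smul_const (entireExp θ)
  convert h2 using 1
  ext1 n
  rw [entireDeriv_pow_entireExp, smul_smul]
  congr 1
  simp only [sub_zero, smul_eq_mul]
  ring

theorem IsSymbolOperator.iterate_apply_entireExp {Φ : ℂ → ℂ}
    {T : entireFunctions →L[ℂ] entireFunctions}
    (hT : IsSymbolOperator Φ T) (hΦ : Differentiable ℂ Φ) (θ : ℂ) (q : ℕ) :
    (T ^ q) (entireExp θ) = Φ θ ^ q • entireExp θ := by
  induction q with
  | zero => simp
  | succ q ih =>
    rw [pow_succ', mul_apply_eq_comp, ih, map_smul, hT.apply_entireExp hΦ, smul_smul,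
      pow_succ]

/-- An entire function of exponential type is the symbol of a convolution operator. -/
theorem exists_isSymbolOperator {Φ : ℂ → ℂ} (hΦ : Differentiable ℂ Φ) {C : ℝ}
    (hC : ∀ w, ‖Φ w‖ ≤ Real.exp (C * ‖w‖)) :
    ∃ T : entireFunctions →L[ℂ] entireFunctions, IsSymbolOperator Φ T := by
  refine exists_hasSum_smul_entireDeriv_pow (K := Real.exp C) (Real.exp_pos C) fun n => ?_
  rcases n.eq_zero_or_pos with rfl | hn
  · simpa using hC 0
  have hn' : (0 : ℝ) < n := by exact_mod_cast hn
  -- Cauchy's estimate on the circle of radius `n`, combined with `n! ≤ n ^ n`, bounds the `n`-th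
  -- derivative by `exp (C * n)`. The radius must be positive, so `n = 0` is separate.
  have h1 := Complex.norm_iteratedDeriv_le_of_forall_mem_sphere_norm_le (F := ℂ) (f := Φ) (c := 0)
    (C := Real.exp (C * n)) n hn' hΦ.diffContOnCl fun x hx => by
      have : ‖x‖ = n := by simpa using hx
      simpa [this] using hC x
  rw [norm_div, Complex.norm_natCast]
  refine div_le_div_of_nonneg_right (h1.trans ?_) (by positivity)
  rw [← Real.exp_nat_mul, div_le_iff₀ (by positivity), mul_comm C, mul_comm]
  gcongr
  exact_mod_cast Nat.factorial_le_pow n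

/-! ### Density of exponentials on a ray. -/

/-- The identity function as an element of `H(ℂ)`. -/
noncomputable def entireId : entireFunctions := ⟨ContinuousMap.id ℂ, differentiable_id⟩

theorem entireId_pow_apply (k : ℕ) (w : ℂ) : (entireId ^ k).1 w = w ^ k := rfl

theorem entireFunctions.sum_smul_apply {ι : Type*} (s : Finset ι) (c : ι → ℂ)
    (f : ι → entireFunctions) (w : ℂ) :
    (∑ i ∈ s, c i • f i).1 w = ∑ i ∈ s, c i * (f i).1 w := by
  rw [AddSubmonoidClass.coe_finsetSum, ContinuousMap.sum_apply]
  rfl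

theorem entireFunctions.hasSum_taylor (f : entireFunctions) :
    HasSum (fun k : ℕ => (iteratedDeriv k f.1 0 / k.factorial) • entireId ^ k) f := by
  rw [HasSum, tendsto_entireFunctions_iff]
  intro R ε hε
  obtain ⟨M, hM0, hM⟩ := entireFunctions.exists_norm_le_of_norm_le f (2 * (|R| + 1))
  have hR : (0 : ℝ) < 2 * (|R| + 1) := by positivity
  have hbd : ∀ (k : ℕ) (w : ℂ), w ∈ Metric.closedBall (0 : ℂ) R →
      ‖iteratedDeriv k f.1 0 / k.factorial * w ^ k‖ ≤ M * (1 / 2) ^ k := by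
    intro k w hw
    have hw' : ‖w‖ ≤ |R| + 1 := by
      have : ‖w‖ ≤ R := by simpa using hw
      linarith [le_abs_self R]
    have h1 : ‖iteratedDeriv k f.1 0‖ ≤ k.factorial * M / (2 * (|R| + 1)) ^ k :=
      Complex.norm_iteratedDeriv_le_of_forall_mem_sphere_norm_le k hR
        (Differentiable.diffContOnCl f.2) fun x hx => hM x (by
          have : ‖x‖ = 2 * (|R| + 1) := by simpa using hx
          exact this.le)
    rw [norm_mul, norm_div, norm_pow, Complex.norm_natCast]
    calc _ ≤ (k.factorial * M / (2 * (|R| + 1)) ^ k) / k.factorial * (|R| + 1) ^ k := by gcongr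
      _ = _ := by
        have h2 : (k.factorial : ℝ) ≠ 0 := by positivity
        have h3 : |R| + 1 ≠ 0 := by positivity
        rw [mul_pow, one_div, inv_pow]
        field_simp
  have hu := tendstoUniformlyOn_tsum (summable_geometric_two.mul_left M) hbd
  filter_upwards [Metric.tendstoUniformlyOn_iff.1 hu ε hε] with s hs w hw
  have := hs w (by simpa using hw)
  rw [dist_comm, dist_eq_norm] at this
  have h4 : f.1 w = ∑' k : ℕ, iteratedDeriv k f.1 0 / k.factorial * w ^ k := by
    rw [← Complex.taylorSeries_eq_of_entire (c := 0) f.2 w]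
    refine tsum_congr fun k => ?_
    simp only [sub_zero, smul_eq_mul]
    ring
  rw [entireFunctions.sum_smul_apply, h4]
  exact this

/-- After the Taylor terms of degree `< k` are removed, `w ^ k` is the leading term as `t → 0`. This
extracts monomials one at a time from exponentials and lower monomials. -/
theorem tendsto_exp_remainder (v : ℂ) (hv : v ≠ 0) (k : ℕ) :
    Tendsto (fun t : ℝ => (k.factorial / (t * v) ^ k) •
      (entireExp (t * v) +
        (-1 : ℂ) • ∑ j ∈ Finset.range k, ((t * v) ^ j / j.factorial) • entireId ^ j))
      (𝓝[>] 0) (𝓝 (entireId ^ k)) := by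
  rw [tendsto_entireFunctions_iff]
  intro R ε hε
  -- The constant of `Complex.exp_bound` for the remainder of order `k + 1`.
  set c : ℝ := ((k + 1).succ : ℝ) * (((k + 1).factorial : ℝ) * (k + 1 : ℕ))⁻¹
  have hv0 : 0 < ‖v‖ := norm_pos_iff.2 hv
  set R' : ℝ := |R| + 1
  have hR' : 0 < R' := by positivity
  have e1 : ∀ᶠ t : ℝ in 𝓝[>] 0, t * (‖v‖ * R') < 1 := by
    have : Tendsto (fun t : ℝ => t * (‖v‖ * R')) (𝓝[>] 0) (𝓝 (0 * (‖v‖ * R'))) :=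
      (tendsto_id.mono_left nhdsWithin_le_nhds).mul_const _
    exact this.eventually_lt_const (by simp)
  have e2 : ∀ᶠ t : ℝ in 𝓝[>] 0, t * (k.factorial * c * R' ^ (k + 1) * ‖v‖) < ε := by
    have : Tendsto (fun t : ℝ => t * (k.factorial * c * R' ^ (k + 1) * ‖v‖)) (𝓝[>] 0)
        (𝓝 (0 * (k.factorial * c * R' ^ (k + 1) * ‖v‖))) :=
      (tendsto_id.mono_left nhdsWithin_le_nhds).mul_const _
    exact this.eventually_lt_const (by simpa using hε)
  filter_upwards [e1, e2, self_mem_nhdsWithin] with t h1 h2 (ht : 0 < t) w hw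
  have hwR : ‖w‖ ≤ R' := by linarith [le_abs_self R]
  have htv : (t * v : ℂ) ≠ 0 := mul_ne_zero (by exact_mod_cast ht.ne') hv
  have hnx : ‖(t * v * w : ℂ)‖ = t * ‖v‖ * ‖w‖ := by
    rw [norm_mul, norm_mul, Complex.norm_real, Real.norm_of_nonneg ht.le]
  have hx1 : ‖(t * v * w : ℂ)‖ ≤ 1 := by
    rw [hnx]
    calc t * ‖v‖ * ‖w‖ ≤ t * ‖v‖ * R' := by gcongr
      _ ≤ 1 := by linarith
  have hb := Complex.exp_bound hx1 (Nat.succ_pos k)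
  have hk : (k.factorial : ℂ) ≠ 0 := by exact_mod_cast k.factorial_ne_zero
  have hval : (((k.factorial / (t * v) ^ k : ℂ) • (entireExp (t * v) +
      (-1 : ℂ) • ∑ j ∈ Finset.range k, ((t * v : ℂ) ^ j / j.factorial) • entireId ^ j) :
        entireFunctions)).1 w - (entireId ^ k).1 w =
      k.factorial / (t * v) ^ k * (Complex.exp (t * v * w) -
        ∑ m ∈ Finset.range (k + 1), (t * v * w) ^ m / m.factorial) := by
    change k.factorial / (t * v) ^ k * (Complex.exp (t * v * w) +
      (-1 : ℂ) * (∑ j ∈ Finset.range k, ((t * v : ℂ) ^ j / j.factorial) • entireId ^ j : entireFunctions).1 w)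
        - w ^ k = _
    rw [entireFunctions.sum_smul_apply, Finset.sum_range_succ]
    have : ∑ i ∈ Finset.range k, (t * v : ℂ) ^ i / i.factorial * (entireId ^ i).1 w =
        ∑ m ∈ Finset.range k, (t * v * w) ^ m / m.factorial :=
      Finset.sum_congr rfl fun j _ => by
        rw [entireId_pow_apply, mul_pow (t * v : ℂ) w]
        ring
    rw [this, mul_pow (t * v : ℂ) w]
    field_simp
    ring
  rw [hval, norm_mul, norm_div, norm_pow, norm_mul, Complex.norm_real, Real.norm_of_nonneg ht.le,
    Complex.norm_natCast]
  calc _ ≤ k.factorial / (t * ‖v‖) ^ k * (‖(t * v * w : ℂ)‖ ^ (k + 1) * c) := by gcongr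
    _ = t * (k.factorial * c * ‖w‖ ^ (k + 1) * ‖v‖) := by
      rw [hnx]
      field_simp
      ring
    _ ≤ t * (k.factorial * c * R' ^ (k + 1) * ‖v‖) := by gcongr
    _ < ε := h2

theorem entireExp_span_dense {v : ℂ} (hv : v ≠ 0) {δ : ℝ} (hδ : 0 < δ) :
    Dense (Submodule.span ℂ ((fun t : ℝ => entireExp (t * v)) '' Ioo 0 δ) :
      Set entireFunctions) := by
  set E := (Submodule.span ℂ ((fun t : ℝ => entireExp (t * v)) '' Ioo 0 δ)).topologicalClosure
  have hE : IsClosed (E : Set entireFunctions) := Submodule.isClosed_topologicalClosure _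
  have hmono : ∀ k : ℕ, entireId ^ k ∈ E := by
    intro k
    induction k using Nat.strong_induction_on with
    | _ k ih =>
      refine hE.mem_of_tendsto (tendsto_exp_remainder v hv k) ?_
      filter_upwards [Ioo_mem_nhdsGT hδ] with t ht
      have h1 : entireExp (t * v) ∈ E :=
        Submodule.le_topologicalClosure _ (Submodule.subset_span ⟨t, ht, rfl⟩)
      have h2 : ∑ j ∈ Finset.range k, ((t * v : ℂ) ^ j / j.factorial) • entireId ^ j ∈ E :=
        E.sum_mem fun j hj => E.smul_mem _ (ih j (Finset.mem_range.1 hj))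
      exact E.smul_mem _ (E.add_mem h1 (E.smul_mem _ h2))
  intro f
  rw [← Submodule.topologicalClosure_coe]
  exact hE.mem_of_tendsto (entireFunctions.hasSum_taylor f)
    (Eventually.of_forall fun s => E.sum_mem fun k _ => E.smul_mem _ (hmono k))

/-- Exponentials with small frequencies on a fixed ray span a dense subspace of `H(ℂ)`. -/
theorem exists_sum_smul_entireExp_mem {v : ℂ} (hv : v ≠ 0) {δ : ℝ} (hδ : 0 < δ)
    {U : Set entireFunctions} (hU : IsOpen U) (hne : U.Nonempty) :
    ∃ (s : Finset ℝ) (c : ℝ → ℂ), (∀ t ∈ s, 0 < t ∧ t < δ) ∧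
      ∑ t ∈ s, c t • entireExp (t * v) ∈ U := by
  obtain ⟨g, hgU, hg⟩ := (entireExp_span_dense hv hδ).exists_mem_open hU hne
  rw [SetLike.mem_coe, Finsupp.mem_span_image_iff_linearCombination] at hgU
  obtain ⟨l, hl, rfl⟩ := hgU
  refine ⟨l.support, l, fun t ht => hl ht, ?_⟩
  rwa [Finsupp.linearCombination_apply] at hg

/-! ### Baire criterion for hypercyclic algebras. -/

/-- The non-unital subalgebra of values at `f` of polynomials without constant term. -/
noncomputable def polynomialValues {X : Type*} [CommRing X] [Algebra ℂ X] (f : X) :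
    NonUnitalSubalgebra ℂ X where
  carrier := {x | ∃ P : Polynomial ℂ, P.coeff 0 = 0 ∧ Polynomial.aeval f P = x}
  zero_mem' := ⟨0, by simp, by simp⟩
  add_mem' := by
    rintro _ _ ⟨P, hP, rfl⟩ ⟨Q, hQ, rfl⟩
    exact ⟨P + Q, by simp [hP, hQ], by simp⟩
  mul_mem' := by
    rintro _ _ ⟨P, hP, rfl⟩ ⟨Q, hQ, rfl⟩
    exact ⟨P * Q, by simp [Polynomial.mul_coeff_zero, hP], by simp⟩
  smul_mem' := by
    rintro c _ ⟨P, hP, rfl⟩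
    exact ⟨c • P, by simp [hP], by simp⟩

/-- If the powers of `f` can be steered simultaneously, then every value at `f` of a nonzero
polynomial without constant term is hypercyclic. -/
theorem isHypercyclicVector_aeval {X : Type*} [CommRing X] [Algebra ℂ X] [TopologicalSpace X]
    [IsTopologicalRing X] [ContinuousConstSMul ℂ X] {T : X →L[ℂ] X} {f : X}
    (hf : ∀ m : ℕ, 1 ≤ m → ∀ V : Set X, IsOpen V → V.Nonempty → ∀ W ∈ 𝓝 (0 : X),
      ∃ q : ℕ, (T ^ q) (f ^ m) ∈ V ∧ ∀ j, 1 ≤ j → j < m → (T ^ q) (f ^ j) ∈ W)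
    {P : Polynomial ℂ} (hP0 : P.coeff 0 = 0) (hP : P ≠ 0) :
    IsHypercyclicVector T (Polynomial.aeval f P) := by
  rw [IsHypercyclicVector, dense_iff_inter_open]
  rintro V hV ⟨y, hy⟩
  set m := P.natDegree with hm
  have hlead : P.coeff m ≠ 0 := by simpa [hm] using hP
  have hm1 : 1 ≤ m := by
    rw [Nat.one_le_iff_ne_zero]
    intro h
    rw [h] at hlead
    exact hlead hP0
  have hcont : Continuous fun x : ℕ → X => ∑ j ∈ Finset.range (m + 1), P.coeff j • x j := by
    fun_prop
  -- The ideal values of `T^q (f ^ j)`: the `m`-th alone produces `y`, the others vanish. Continuity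
  -- leaves room around them.
  let x₀ : ℕ → X := fun j => if j = m then (P.coeff m)⁻¹ • y else 0
  have hx₀ : ∑ j ∈ Finset.range (m + 1), P.coeff j • x₀ j = y := by
    rw [Finset.sum_range_succ, Finset.sum_eq_zero]
    · simp [x₀, smul_smul, hlead]
    · intro j hj
      simp [x₀, (Finset.mem_range.1 hj).ne]
  have hnhds : (fun x : ℕ → X => ∑ j ∈ Finset.range (m + 1), P.coeff j • x j) ⁻¹' V ∈ 𝓝 x₀ :=
    hcont.continuousAt.preimage_mem_nhds (by rw [hx₀]; exact hV.mem_nhds hy)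
  rw [nhds_pi, Filter.mem_pi] at hnhds
  obtain ⟨I, hI, t, ht, hsub⟩ := hnhds
  obtain ⟨V', hV't, hV', hyV'⟩ := mem_nhds_iff.1 (ht m)
  have hW : (⋂ j ∈ Finset.range m, t j) ∈ 𝓝 (0 : X) := by
    rw [Filter.biInter_finset_mem]
    intro j hj
    have := ht j
    simpa [x₀, (Finset.mem_range.1 hj).ne] using this
  obtain ⟨q, hqV, hqW⟩ := hf m hm1 V' hV' ⟨_, hyV'⟩ _ hW
  refine ⟨(T ^ q) (Polynomial.aeval f P), ?_, q, ?_⟩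
  -- Coordinates `0` and `> m` do not affect the sum, as `P.coeff 0 = 0`; they keep their ideal
  -- values so that `x` lies in the box.
  · let x : ℕ → X := fun j => if j = 0 ∨ m < j then x₀ j else (T ^ q) (f ^ j)
    have hx : x ∈ I.pi t := by
      intro j _
      by_cases h : j = 0 ∨ m < j
      · simp only [x, if_pos h]
        exact mem_of_mem_nhds (ht j)
      · simp only [x, if_neg h]
        rw [not_or, not_lt] at h
        rcases h.2.eq_or_lt with rfl | hlt
        · exact hV't hqV
        · have := hqW j (Nat.one_le_iff_ne_zero.2 h.1) hlt
          simp only [mem_iInter] at this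
          exact this j (Finset.mem_range.2 hlt)
    have := hsub hx
    rw [Polynomial.aeval_eq_sum_range, map_sum]
    simp only [mem_preimage] at this
    convert this using 1
    refine Finset.sum_congr rfl fun j hj => ?_
    rw [map_smul]
    rcases j.eq_zero_or_pos with rfl | hj0
    · simp [hP0]
    · have : ¬(j = 0 ∨ m < j) := by
        have := Finset.mem_range.1 hj
        omega
      simp only [x, if_neg this]
  · simp only [FunLike.coe_pow_eq_iterate]

/-- A Baire category criterion for the existence of a hypercyclic algebra. -/
theorem hasHypercyclicAlgebra_of_steering {X : Type*} [CommRing X] [Algebra ℂ X]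
    [TopologicalSpace X] [IsTopologicalRing X] [ContinuousConstSMul ℂ X] [BaireSpace X]
    [SecondCountableTopology X] [T1Space X] [Nontrivial X] (T : X →L[ℂ] X)
    (h : ∀ m : ℕ, 1 ≤ m → ∀ U V : Set X, IsOpen U → U.Nonempty → IsOpen V → V.Nonempty →
      ∀ W ∈ 𝓝 (0 : X), ∃ f ∈ U, ∃ q : ℕ, (T ^ q) (f ^ m) ∈ V ∧
        ∀ j, 1 ≤ j → j < m → (T ^ q) (f ^ j) ∈ W) :
    HasHypercyclicAlgebra T := by
  obtain ⟨B, hBc, hBne, hB⟩ := TopologicalSpace.exists_countable_basis X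
  -- The first index stands for `m - 1`, which builds in `1 ≤ m`.
  let G : ℕ × B × B → Set X := fun p =>
    {f | ∃ q : ℕ, (T ^ q) (f ^ (p.1 + 1)) ∈ (p.2.1 : Set X) ∧
      ∀ j ∈ Finset.Icc 1 p.1, (T ^ q) (f ^ j) ∈ (p.2.2 : Set X)}
  have hcont : ∀ q j : ℕ, Continuous fun f : X => (T ^ q) (f ^ j) := fun q j =>
    (T ^ q).continuous.comp (continuous_pow j)
  have : Countable B := hBc
  -- Imposes nothing when the second basic set is not a neighbourhood of `0`, so that all of `B × B`
  -- can be the index set.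
  let G' : ℕ × B × B → Set X := fun p => {f | (0 : X) ∈ (p.2.2 : Set X) → f ∈ G p}
  have hGo : ∀ p, IsOpen (G' p) := by
    intro p
    by_cases h0 : (0 : X) ∈ (p.2.2 : Set X)
    · have : G' p = ⋃ q : ℕ, (fun f : X => (T ^ q) (f ^ (p.1 + 1))) ⁻¹' p.2.1 ∩
          ⋂ j ∈ Finset.Icc 1 p.1, (fun f : X => (T ^ q) (f ^ j)) ⁻¹' p.2.2 := by
        ext f
        simp [G', G, h0]
      rw [this]
      exact isOpen_iUnion fun q => ((hB.isOpen p.2.1.2).preimage (hcont _ _)).inter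
        (isOpen_biInter_finset fun j _ => (hB.isOpen p.2.2.2).preimage (hcont _ _))
    · simp [G', h0]
  have hGd : ∀ p, Dense (G' p) := by
    intro p
    rw [dense_iff_inter_open]
    intro U hU hUne
    by_cases h0 : (0 : X) ∈ (p.2.2 : Set X)
    · obtain ⟨f, hfU, q, hq, hq'⟩ := h (p.1 + 1) (by omega) U p.2.1 hU hUne
        (hB.isOpen p.2.1.2) (nonempty_iff_ne_empty.2 fun he => hBne (he ▸ p.2.1.2)) p.2.2
        ((hB.isOpen p.2.2.2).mem_nhds h0)
      refine ⟨f, hfU, fun _ => ⟨q, hq, fun j hj => ?_⟩⟩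
      rw [Finset.mem_Icc] at hj
      exact hq' j hj.1 (by omega)
    · obtain ⟨f, hf⟩ := hUne
      exact ⟨f, hf, fun h => absurd h h0⟩
  have hdense := dense_iInter_of_isOpen hGo hGd
  obtain ⟨f, hf, hf0⟩ := hdense.exists_mem_open (isOpen_compl_singleton (x := (0 : X)))
    (exists_ne 0)
  rw [mem_iInter] at hf
  refine ⟨polynomialValues f, ⟨f, ⟨Polynomial.X, by simp, by simp⟩, hf0⟩, ?_⟩
  rintro _ ⟨P, hP0, rfl⟩ hne
  refine isHypercyclicVector_aeval (fun m hm V hV hVne W hW => ?_) hP0 (by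
    rintro rfl
    simp at hne)
  obtain ⟨y, hy⟩ := hVne
  obtain ⟨V', hV'B, -, hV'⟩ := hB.exists_subset_of_mem_open hy hV
  obtain ⟨W', hW'B, h0, hW'⟩ := hB.mem_nhds_iff.1 hW
  obtain ⟨q, hq, hq'⟩ := hf (m - 1, ⟨V', hV'B⟩, ⟨W', hW'B⟩) h0
  simp only [Nat.sub_add_cancel hm] at hq
  exact ⟨q, hV' hq, fun j hj hjm => hW' (hq' j (Finset.mem_Icc.2 ⟨hj, by simp; omega⟩))⟩

/-! ### Convexity of `log |Φ|` along a ray. -/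

/-- A square root `v` of `c⁻¹` makes `v ^ 2 * c = 1`; the remaining freedom of sign fixes the
first-order condition. -/
theorem exists_sq_mul_re_pos {c : ℂ} (hc : c ≠ 0) (b : ℂ) :
    ∃ v : ℂ, v ≠ 0 ∧ 0 < (v ^ 2 * c).re ∧ 0 ≤ (b * v).re := by
  obtain ⟨v, hv⟩ := IsAlgClosed.exists_pow_nat_eq c⁻¹ two_pos
  have h1 : v ^ 2 * c = 1 := by rw [hv, inv_mul_cancel₀ hc]
  have hv0 : v ≠ 0 := by
    rintro rfl
    simp at h1
  rcases le_total 0 (b * v).re with h | h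
  · exact ⟨v, hv0, by simp [h1], h⟩
  · refine ⟨-v, neg_ne_zero.2 hv0, by simp [h1], ?_⟩
    rw [mul_neg, Complex.neg_re]
    linarith

/-- Along a suitable ray, the real part of a holomorphic function with nonzero second derivative
is strictly convex and positive near the origin. -/
theorem exists_strictConvexOn_re {g : ℂ → ℂ} (hg : AnalyticAt ℂ g 0)
    (hc : deriv (deriv g) 0 ≠ 0) (h0 : g 0 = 0) :
    ∃ v : ℂ, v ≠ 0 ∧ ∃ η : ℝ, 0 < η ∧
      StrictConvexOn ℝ (Icc 0 η) (fun s : ℝ => (g (s * v)).re) ∧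
      ∀ s ∈ Ioc 0 η, 0 < (g (s * v)).re := by
  obtain ⟨v, hv, hvc, hvb⟩ := exists_sq_mul_re_pos hc (deriv g 0)
  have hpos : ∀ᶠ z in 𝓝 (0 : ℂ), 0 < (v ^ 2 * deriv (deriv g) z).re := by
    have : ContinuousAt (fun z => (v ^ 2 * deriv (deriv g) z).re) 0 :=
      Complex.continuous_re.continuousAt.comp (continuousAt_const.mul hg.deriv.deriv.continuousAt)
    exact this.eventually_const_lt hvc
  have hline : Tendsto (fun s : ℝ => (s : ℂ) * v) (𝓝 0) (𝓝 0) := by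
    have : Continuous fun s : ℝ => (s : ℂ) * v := by fun_prop
    simpa using this.tendsto 0
  obtain ⟨ε, hε, hball⟩ := Metric.eventually_nhds_iff.1
    (hline.eventually (hg.eventually_analyticAt.and hpos))
  have hmul : ∀ s : ℝ, HasDerivAt (fun s : ℝ => (s : ℂ) * v) v s := fun s => by
    simpa using (Complex.ofRealCLM.hasDerivAt (x := s)).mul_const v
  have hre : ∀ (F : ℂ → ℂ) (s : ℝ), DifferentiableAt ℂ F (s * v) →
      HasDerivAt (fun s : ℝ => (F (s * v)).re) (deriv F (s * v) * v).re s := fun F s hF =>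
    Complex.reCLM.hasFDerivAt.comp_hasDerivAt s (hF.hasDerivAt.comp s (hmul s))
  have hd1 : ∀ s : ℝ, |s| < ε →
      HasDerivAt (fun s : ℝ => (g (s * v)).re) (deriv g (s * v) * v).re s := fun s hs =>
    hre g s (hball (by simpa using hs)).1.differentiableAt
  have hd2 : ∀ s : ℝ, |s| < ε →
      HasDerivAt (fun s : ℝ => (deriv g (s * v) * v).re) (v ^ 2 * deriv (deriv g) (s * v)).re s := by
    intro s hs
    have hda := (hball (y := s) (by simpa using hs)).1.deriv.differentiableAt
    have := hre (fun z => deriv g z * v) s (hda.mul_const v)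
    rw [deriv_mul_const hda] at this
    convert this using 2
    ring
  have habs : ∀ s ∈ Icc 0 (ε / 2), |s| < ε := fun s hs => by
    rw [abs_of_nonneg hs.1]
    linarith [hs.2]
  have hconv : StrictConvexOn ℝ (Icc 0 (ε / 2)) (fun s : ℝ => (g (s * v)).re) := by
    refine strictConvexOn_of_deriv2_pos (convex_Icc _ _)
      (fun s hs => (hd1 s (habs s hs)).continuousAt.continuousWithinAt) fun s hs => ?_
    have hs' := habs s (interior_subset hs)
    have heq : deriv (fun s : ℝ => (g (s * v)).re) =ᶠ[𝓝 s]
        fun s : ℝ => (deriv g (s * v) * v).re := by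
      filter_upwards [continuous_abs.continuousAt.eventually_lt_const hs'] with x hx
      exact (hd1 x hx).deriv
    change 0 < deriv (deriv _) s
    rw [heq.deriv_eq, (hd2 s hs').deriv]
    exact (hball (by simpa using hs')).2
  have hzero : (g ((0 : ℝ) * v)).re = 0 := by simp [h0]
  -- A convex function lies above its tangent at `0`, whose slope is nonnegative by the choice of
  -- `v`.
  have hnn : ∀ s ∈ Ioc 0 (ε / 2), 0 ≤ (g (s * v)).re := by
    intro s hs
    have h1 := hconv.convexOn.le_slope_of_hasDerivAt (x := 0) ⟨le_rfl, by positivity⟩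
      ⟨hs.1.le, hs.2⟩ hs.1 (hd1 0 (by simpa using hε))
    rw [slope_def_field, hzero] at h1
    have h2 : 0 ≤ (deriv g ((0 : ℝ) * v) * v).re := by simpa using hvb
    have h3 := h2.trans h1
    rw [sub_zero, sub_zero] at h3
    by_contra hneg
    exact absurd h3 (not_le.2 (div_neg_of_neg_of_pos (not_le.1 hneg) hs.1))
  refine ⟨v, hv, ε / 2, by positivity, hconv, fun s hs => ?_⟩
  -- Strict convexity at the midpoint of `0` and `s` upgrades nonnegativity to positivity.
  have h1 := hnn (s / 2) ⟨half_pos hs.1, by linarith [hs.1, hs.2]⟩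
  have h2 := hconv.2 (x := 0) ⟨le_rfl, by positivity⟩ (y := s) ⟨hs.1.le, hs.2⟩ hs.1.ne
    (half_pos one_pos) (half_pos one_pos) (by norm_num)
  simp only [smul_eq_mul, mul_zero, zero_add] at h2
  rw [hzero, mul_zero, zero_add] at h2
  rw [show 1 / 2 * s = s / 2 by ring] at h2
  linarith

/-- Strict Jensen inequality for sums of at most `m` points, the missing points being `0`. -/
theorem StrictConvexOn.map_sum_lt_of_card_le {h : ℝ → ℝ} {η : ℝ} (hη : 0 ≤ η)
    (hh : StrictConvexOn ℝ (Icc 0 η) h) (h0 : h 0 = 0) {m n : ℕ} (hm : 1 ≤ m) (hnm : n ≤ m)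
    {s : Fin n → ℝ} (hs0 : ∀ i, 0 ≤ s i) (hsη : ∀ i, m * s i ≤ η) (hne : ∃ i, s i ≠ 0)
    (hex : ¬(n = m ∧ ∀ i j, s i = s j)) :
    h (∑ i, s i) < ∑ i, h (m * s i) / m := by
  have hm0 : (0 : ℝ) < m := by exact_mod_cast hm
  have hnm' : (n : ℝ) ≤ m := by exact_mod_cast hnm
  -- The `m - n` missing points are lumped into `none`, placed at `0`.
  let w : Option (Fin n) → ℝ := fun o => o.elim ((m - n) / m) fun _ => 1 / m
  let p : Option (Fin n) → ℝ := fun o => o.elim 0 fun i => m * s i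
  have key := (hh.map_sum_lt_iff_of_nonneg (t := Finset.univ) (w := w) (p := p) (by
      rintro (_ | i) -
      · exact div_nonneg (sub_nonneg.2 hnm') hm0.le
      · change 0 ≤ 1 / (m : ℝ)
        positivity) (by
      rw [Fintype.sum_option]
      simp only [w, Option.elim, Finset.sum_const, Finset.card_univ, Fintype.card_fin,
        nsmul_eq_mul]
      field_simp
      ring) (by
      rintro (_ | i) -
      · exact ⟨le_rfl, hη⟩
      · exact ⟨mul_nonneg hm0.le (hs0 i), hsη i⟩)).2 (by
      rcases hnm.eq_or_lt with rfl | hlt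
      · have : ¬∀ i j, s i = s j := fun h => hex ⟨rfl, h⟩
        push Not at this
        obtain ⟨i, j, hij⟩ := this
        refine ⟨some i, Finset.mem_univ _, some j, Finset.mem_univ _, ?_, ?_, ?_⟩
        · exact (one_div_pos.2 hm0).ne'
        · exact (one_div_pos.2 hm0).ne'
        · exact fun h => hij (mul_left_cancel₀ hm0.ne' h)
      · obtain ⟨i, hi⟩ := hne
        refine ⟨none, Finset.mem_univ _, some i, Finset.mem_univ _, ?_, ?_, ?_⟩
        · have : (n : ℝ) < m := by exact_mod_cast hlt
          exact (div_pos (sub_pos.2 this) hm0).ne'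
        · exact (one_div_pos.2 hm0).ne'
        · exact (mul_ne_zero hm0.ne' hi).symm)
  simp only [Fintype.sum_option, w, p, Option.elim, smul_eq_mul, mul_zero, zero_add, h0] at key
  have e1 : ∀ i, 1 / (m : ℝ) * (m * s i) = s i := fun i => by field_simp
  have e2 : ∀ i, 1 / (m : ℝ) * h (m * s i) = h (m * s i) / m := fun i => by ring
  simpa only [e1, e2] using key

/-- With `h s = log ‖Φ (s * v)‖`, the normalisation gives `log ‖μ i‖ = -h (m * s i) / m`. The
logarithm of the product is thus `h (∑ s i) - ∑ h (m * s i) / m`, negative by strict Jensen. The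
excluded case is the one where the product equals `1`. -/
theorem norm_prod_mul_lt_one {Φ : ℂ → ℂ} {v : ℂ} {η : ℝ} (hη : 0 ≤ η) (hΦ0 : Φ 0 = 1)
    (hconv : StrictConvexOn ℝ (Icc 0 η) fun s : ℝ => Real.log ‖Φ (s * v)‖)
    {m n : ℕ} (hm : 1 ≤ m) (hnm : n ≤ m) {s : Fin n → ℝ} {μ : Fin n → ℂ} (hs0 : ∀ i, 0 ≤ s i)
    (hsη : ∀ i, m * s i ≤ η) (hμ : ∀ i, μ i ^ m * Φ ((m * s i : ℝ) * v) = 1)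
    (hne : ∃ i, s i ≠ 0) (hex : ¬(n = m ∧ ∀ i j, s i = s j)) :
    ‖(∏ i, μ i) * Φ ((∑ i, s i : ℝ) * v)‖ < 1 := by
  have hm0 : (0 : ℝ) < m := by exact_mod_cast hm
  have key := hconv.map_sum_lt_of_card_le hη (by simp [hΦ0]) hm hnm hs0 hsη hne hex
  by_cases hz : Φ ((∑ i, s i : ℝ) * v) = 0
  · rw [hz]
    simp
  have hμ0 : ∀ i, μ i ≠ 0 := fun i h => by
    have := hμ i
    rw [h, zero_pow (by omega), zero_mul] at this
    exact zero_ne_one this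
  have hlog : ∀ i, Real.log ‖μ i‖ = -(Real.log ‖Φ ((m * s i : ℝ) * v)‖ / m) := fun i => by
    have h1 := congrArg norm (hμ i)
    rw [norm_mul, norm_pow, norm_one] at h1
    have hΦi : ‖Φ ((m * s i : ℝ) * v)‖ ≠ 0 := fun h => by
      rw [h, mul_zero] at h1
      exact zero_ne_one h1
    have h2 := congrArg Real.log h1
    rw [Real.log_mul (pow_ne_zero _ (norm_ne_zero_iff.2 (hμ0 i))) hΦi, Real.log_pow,
      Real.log_one] at h2
    field_simp
    linarith
  have hprod : ∏ i, ‖μ i‖ ≠ 0 := Finset.prod_ne_zero_iff.2 fun i _ => norm_ne_zero_iff.2 (hμ0 i)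
  rw [norm_mul, norm_prod, ← Real.log_neg_iff (by
      have := norm_pos_iff.2 hz
      have h2 : 0 ≤ ∏ i, ‖μ i‖ := Finset.prod_nonneg fun i _ => norm_nonneg _
      positivity),
    Real.log_mul hprod (norm_ne_zero_iff.2 hz),
    Real.log_prod fun i _ => norm_ne_zero_iff.2 (hμ0 i), Finset.sum_congr rfl fun i _ => hlog i,
    Finset.sum_neg_distrib]
  linarith

/-- Only finitely many strict inequalities are involved, so they survive a small shift `y` of the
frequency. In the application `none` marks a factor from the unscaled sum, and `y` collects the
frequencies of those factors. -/
theorem eventually_norm_prod_mul_lt_one {Φ : ℂ → ℂ} (hΦ : Continuous Φ) {v : ℂ} {η : ℝ}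
    (hη : 0 ≤ η) (hΦ0 : Φ 0 = 1)
    (hconv : StrictConvexOn ℝ (Icc 0 η) fun s : ℝ => Real.log ‖Φ (s * v)‖)
    {m : ℕ} (hm : 1 ≤ m) {J : Type*} [Finite J] {s : J → ℝ} {μ : J → ℂ} (hs0 : ∀ j, 0 < s j)
    (hs : Function.Injective s) (hsη : ∀ j, m * s j ≤ η)
    (hμ : ∀ j, μ j ^ m * Φ ((m * s j : ℝ) * v) = 1) :
    ∀ᶠ y in 𝓝 (0 : ℂ), ∀ n ≤ m, ∀ p : Fin n → Option J, (∃ i, p i ≠ none) →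
      ¬(n = m ∧ ∃ j, ∀ i, p i = some j) →
      ‖(∏ i, (p i).elim 1 μ) * Φ ((∑ i, (p i).elim 0 s : ℝ) * v + y)‖ < 1 := by
  have hfin : ∀ᶠ y in 𝓝 (0 : ℂ), ∀ n : Fin (m + 1), ∀ p : Fin n → Option J, (∃ i, p i ≠ none) →
      ¬((n : ℕ) = m ∧ ∃ j, ∀ i, p i = some j) →
      ‖(∏ i, (p i).elim 1 μ) * Φ ((∑ i, (p i).elim 0 s : ℝ) * v + y)‖ < 1 := by
    rw [eventually_all]
    intro n
    rw [eventually_all]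
    intro p
    simp only [eventually_imp_distrib_left]
    rintro ⟨i₀, hi₀⟩ hex
    obtain ⟨j₀, hj₀⟩ := Option.ne_none_iff_exists'.1 hi₀
    have hlt : ‖(∏ i, (p i).elim 1 μ) * Φ ((∑ i, (p i).elim 0 s : ℝ) * v)‖ < 1 := by
      -- A `none` factor counts as `s = 0`, `μ = 1`, which meets the normalisation because `Φ 0 =
      -- 1`.
      refine norm_prod_mul_lt_one hη hΦ0 hconv hm (Nat.lt_succ_iff.1 n.2) (fun i => ?_)
        (fun i => ?_) (fun i => ?_) ⟨i₀, ?_⟩ ?_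
      · rcases p i with _ | j
        · exact le_rfl
        · exact (hs0 j).le
      · rcases p i with _ | j
        · simpa using hη
        · exact hsη j
      · rcases p i with _ | j
        · simp [hΦ0]
        · exact hμ j
      · rw [hj₀]
        exact (hs0 j₀).ne'
      · rintro ⟨hnm, hall⟩
        refine hex ⟨hnm, j₀, fun i => ?_⟩
        have := hall i i₀
        rw [hj₀] at this
        rcases hpi : p i with _ | j
        · rw [hpi] at this
          exact absurd this (hs0 j₀).ne
        · rw [hpi] at this
          rw [hs this]
    have hcont : ContinuousAt
        (fun y => ‖(∏ i, (p i).elim 1 μ) * Φ ((∑ i, (p i).elim 0 s : ℝ) * v + y)‖) 0 := by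
      fun_prop
    exact hcont.eventually_lt_const (by simpa only [add_zero] using hlt)
  filter_upwards [hfin] with y hy n hn
  exact hy ⟨n, Nat.lt_succ_iff.2 hn⟩

/-! ### Steering powers of combinations of exponentials. -/

/-- Asymptotics of `Tᵠ` on powers of combinations of exponentials whose coefficients are
geometric in `q`. -/
theorem IsSymbolOperator.tendsto_iterate_pow {Φ : ℂ → ℂ}
    {T : entireFunctions →L[ℂ] entireFunctions} (hT : IsSymbolOperator Φ T)
    (hΦ : Differentiable ℂ Φ) {K : Type*} [Fintype K] (c κ θ : K → ℂ) (n : ℕ)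
    {ℓ : (Fin n → K) → ℂ}
    (hℓ : ∀ p, Tendsto (fun q : ℕ => ((∏ i, κ (p i)) * Φ (∑ i, θ (p i))) ^ q) atTop (𝓝 (ℓ p))) :
    Tendsto (fun q : ℕ => (T ^ q) ((∑ k, (c k * κ k ^ q) • entireExp (θ k)) ^ n)) atTop
      (𝓝 (∑ p : Fin n → K, ((∏ i, c (p i)) * ℓ p) • entireExp (∑ i, θ (p i)))) := by
  have heq : ∀ q : ℕ, (T ^ q) ((∑ k, (c k * κ k ^ q) • entireExp (θ k)) ^ n) =
      ∑ p : Fin n → K, ((∏ i, c (p i)) * ((∏ i, κ (p i)) * Φ (∑ i, θ (p i))) ^ q) •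
        entireExp (∑ i, θ (p i)) := by
    intro q
    rw [Fintype.sum_pow, map_sum]
    refine Finset.sum_congr rfl fun p _ => ?_
    rw [Finset.prod_smul, prod_entireExp, map_smul, hT.iterate_apply_entireExp hΦ, smul_smul,
      Finset.prod_mul_distrib, Finset.prod_pow, mul_pow, mul_assoc]
  simp only [heq]
  exact tendsto_finsetSum _ fun p _ => ((hℓ p).const_mul _).smul_const _

/-- The limit of `Tᵠ (f_q ^ n)` for `n ≤ m`, where `f_q` combines a fixed sum of exponentials with
frequencies `t i * v'` and decaying multiples of exponentials with frequencies `s j * v`. -/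
theorem IsSymbolOperator.tendsto_iterate_pow_sum {Φ : ℂ → ℂ}
    {T : entireFunctions →L[ℂ] entireFunctions} (hT : IsSymbolOperator Φ T)
    (hΦ : Differentiable ℂ Φ) {I J : Type*} [Fintype I] [Fintype J] {m : ℕ} (hm : 1 ≤ m)
    {v v' : ℂ} {s : J → ℝ} {t : I → ℝ} {μ : J → ℂ} (α : I → ℂ) (r : J → ℂ)
    (hμ : ∀ j, μ j ^ m * Φ ((m * s j : ℝ) * v) = 1)
    (hI : ∀ n, 1 ≤ n → n ≤ m → ∀ p : Fin n → I, ‖Φ ((∑ i, t (p i) : ℝ) * v')‖ < 1)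
    (hJ : ∀ n ≤ m, ∀ p : Fin n → I ⊕ J, (∃ i, ∃ j, p i = Sum.inr j) →
      ¬(n = m ∧ ∃ j, ∀ i, p i = Sum.inr j) →
      ‖(∏ i, (p i).elim 1 μ) *
        Φ (∑ i, (p i).elim (fun i => (t i * v' : ℂ)) fun j => (s j * v : ℂ))‖ < 1)
    {n : ℕ} (hn : 1 ≤ n) (hnm : n ≤ m) :
    Tendsto (fun q : ℕ => (T ^ q) ((∑ i, α i • entireExp (t i * v') +
      ∑ j, (r j * μ j ^ q) • entireExp (s j * v)) ^ n)) atTop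
      (𝓝 (if n = m then ∑ j, r j ^ m • entireExp ((m * s j : ℝ) * v) else 0)) := by
  classical
  let c : I ⊕ J → ℂ := Sum.elim α r
  let κ : I ⊕ J → ℂ := Sum.elim 1 μ
  let θ : I ⊕ J → ℂ := Sum.elim (fun i => (t i * v' : ℂ)) fun j => (s j * v : ℂ)
  have hlt : ∀ p : Fin n → I ⊕ J, ¬(n = m ∧ ∃ j, ∀ i, p i = Sum.inr j) →
      ‖(∏ i, κ (p i)) * Φ (∑ i, θ (p i))‖ < 1 := by
    intro p hp
    by_cases hall : ∃ i, ∃ j, p i = Sum.inr j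
    · exact hJ n hnm p hall hp
    · have hl : ∀ i, ∃ x, p i = Sum.inl x := fun i => by
        rcases hpi : p i with x | j
        · exact ⟨x, rfl⟩
        · exact absurd ⟨i, j, hpi⟩ hall
      choose x hx using hl
      have := hI n hn hnm x
      simpa [hx, κ, θ, Finset.sum_mul] using this
  have hconst : ∀ p : Fin n → I ⊕ J, (n = m ∧ ∃ j, ∀ i, p i = Sum.inr j) →
      (∏ i, κ (p i)) * Φ (∑ i, θ (p i)) = 1 := by
    rintro p ⟨rfl, j, hj⟩
    have := hμ j
    simp only [hj, κ, θ, Sum.elim_inr, Finset.prod_const, Finset.sum_const, Finset.card_univ,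
      Fintype.card_fin, nsmul_eq_mul]
    rw [← this]
    push_cast
    ring_nf
  have hlim := hT.tendsto_iterate_pow hΦ c κ θ n
    (ℓ := fun p => if n = m ∧ ∃ j, ∀ i, p i = Sum.inr j then 1 else 0) (fun p => by
      split_ifs with h
      · simp only [hconst p h, one_pow]
        exact tendsto_const_nhds
      · exact tendsto_pow_atTop_nhds_zero_of_norm_lt_one (hlt p h))
  have hL : ∑ p : Fin n → I ⊕ J, ((∏ i, c (p i)) *
        if n = m ∧ ∃ j, ∀ i, p i = Sum.inr j then (1 : ℂ) else 0) • entireExp (∑ i, θ (p i)) =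
      if n = m then ∑ j, r j ^ m • entireExp ((m * s j : ℝ) * v) else 0 := by
    split_ifs with h
    · subst h
      symm
      -- Only constant tuples in `J` survive, one for each `j`; `1 ≤ n` makes this indexing
      -- injective.
      refine Finset.sum_of_injOn (fun j _ => Sum.inr j) ?_
        (fun _ _ => Finset.mem_coe.2 (Finset.mem_univ _)) ?_ ?_
      · intro j _ j' _ hjj
        exact Sum.inr_injective (congrFun hjj ⟨0, hn⟩)
      · intro p _ hp
        rw [if_neg, mul_zero, zero_smul]
        rintro ⟨-, j, hj⟩
        exact hp ⟨j, by simp, (funext hj).symm⟩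
      · intro j _
        rw [if_pos ⟨rfl, j, fun _ => rfl⟩]
        simp only [c, θ, Sum.elim_inr, Finset.prod_const, Finset.sum_const, Finset.card_univ,
          Fintype.card_fin, nsmul_eq_mul, mul_one]
        push_cast
        rw [mul_assoc]
    · refine Finset.sum_eq_zero fun p _ => ?_
      rw [if_neg fun h' => h h'.1, mul_zero, zero_smul]
  rw [hL] at hlim
  simpa [Fintype.sum_sum_type, c, κ, θ] using hlim

theorem IsSymbolOperator.exists_steering {Φ : ℂ → ℂ}
    {T : entireFunctions →L[ℂ] entireFunctions} (hT : IsSymbolOperator Φ T)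
    (hΦ : Differentiable ℂ Φ) (hΦ0 : Φ 0 = 1) {v v' : ℂ} (hv : v ≠ 0) (hv' : v' ≠ 0) {η η' : ℝ}
    (hη : 0 < η) (hη' : 0 < η')
    (hconv : StrictConvexOn ℝ (Icc 0 η) fun s : ℝ => Real.log ‖Φ (s * v)‖)
    (hgt : ∀ s : ℝ, s ∈ Ioc 0 η → 1 < ‖Φ (s * v)‖)
    (hlt : ∀ s : ℝ, s ∈ Ioc 0 η' → ‖Φ (s * v')‖ < 1)
    {m : ℕ} (hm : 1 ≤ m) {U V : Set entireFunctions} (hU : IsOpen U) (hUne : U.Nonempty)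
    (hV : IsOpen V) (hVne : V.Nonempty) {W : Set entireFunctions}
    (hW : W ∈ 𝓝 (0 : entireFunctions)) :
    ∃ f ∈ U, ∃ q : ℕ, (T ^ q) (f ^ m) ∈ V ∧ ∀ j, 1 ≤ j → j < m → (T ^ q) (f ^ j) ∈ W := by
  have hm0 : (0 : ℝ) < m := by exact_mod_cast hm
  obtain ⟨S, β, hS, hSV⟩ := exists_sum_smul_entireExp_mem hv hη hV hVne
  -- The `m`-th power of the exponential then recovers the frequency `x` of the target; likewise `r`
  -- below is an `m`-th root of its coefficient.
  let s : S → ℝ := fun x => x.1 / m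
  have hms : ∀ x : S, m * s x = x.1 := fun x => mul_div_cancel₀ _ hm0.ne'
  have hΦgt : ∀ x : S, 1 < ‖Φ ((x.1 : ℝ) * v)‖ := fun x => hgt _ ⟨(hS _ x.2).1, (hS _ x.2).2.le⟩
  have hΦne : ∀ x : S, Φ ((x.1 : ℝ) * v) ≠ 0 := fun x => by
    have := hΦgt x
    intro h
    rw [h, norm_zero] at this
    linarith
  choose μ hμ using fun x : S => IsAlgClosed.exists_pow_nat_eq (Φ ((x.1 : ℝ) * v))⁻¹ hm
  choose r hr using fun x : S => IsAlgClosed.exists_pow_nat_eq (β x.1) hm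
  have hμ1 : ∀ x, μ x ^ m * Φ ((m * s x : ℝ) * v) = 1 := fun x => by
    rw [hms, hμ, inv_mul_cancel₀ (hΦne x)]
  have hμlt : ∀ x, ‖μ x‖ < 1 := fun x => by
    have h1 : ‖μ x‖ ^ m < 1 := by
      rw [← norm_pow, hμ, norm_inv]
      exact inv_lt_one_of_one_lt₀ (hΦgt x)
    by_contra h
    exact absurd h1 (not_lt.2 (one_le_pow₀ (not_lt.1 h)))
  have hev := eventually_norm_prod_mul_lt_one hΦ.continuous hη.le hΦ0 hconv hm (s := s) (μ := μ)
    (fun x => div_pos (hS _ x.2).1 hm0)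
    (fun x y hxy => Subtype.ext (by rw [← hms x, ← hms y, hxy]))
    (fun x => by rw [hms]; exact (hS _ x.2).2.le) hμ1
  obtain ⟨δ, hδ, hball⟩ := Metric.eventually_nhds_iff.1 hev
  have hv'0 : 0 < ‖v'‖ := norm_pos_iff.2 hv'
  -- The frequencies `t` are taken below `δ' / m`, so a sum of at most `m` of them stays where `|Φ|
  -- < 1` on the ray of `v'` and shifts by less than `δ`. Here `δ` depends only on the target.
  set δ' : ℝ := min η' (δ / (2 * ‖v'‖))
  have hδ'0 : 0 < δ' := lt_min hη' (by positivity)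
  obtain ⟨R, α, hR, hRU⟩ := exists_sum_smul_entireExp_mem hv' (div_pos hδ'0 hm0) hU hUne
  let t : R → ℝ := fun x => x.1
  have hsum : ∀ n ≤ m, ∀ p : Fin n → Option R, 0 ≤ ∑ i, (p i).elim 0 t ∧
      ∑ i, (p i).elim 0 t ≤ δ' := by
    intro n hn p
    have h1 : ∀ i, 0 ≤ (p i).elim 0 t ∧ (p i).elim 0 t ≤ δ' / m := fun i => by
      rcases p i with _ | x
      · exact ⟨le_rfl, by simp only [Option.elim]; positivity⟩
      · exact ⟨(hR _ x.2).1.le, (hR _ x.2).2.le⟩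
    refine ⟨Finset.sum_nonneg fun i _ => (h1 i).1, ?_⟩
    calc _ ≤ ∑ _i : Fin n, δ' / m := Finset.sum_le_sum fun i _ => (h1 i).2
      _ = n * (δ' / m) := by simp
      _ ≤ m * (δ' / m) := by gcongr
      _ = δ' := mul_div_cancel₀ _ hm0.ne'
  have hI : ∀ n, 1 ≤ n → n ≤ m → ∀ p : Fin n → R, ‖Φ ((∑ i, t (p i) : ℝ) * v')‖ < 1 := by
    intro n hn hnm p
    refine hlt _ ⟨Finset.sum_pos (fun i _ => (hR _ (p i).2).1) ⟨⟨0, hn⟩, Finset.mem_univ _⟩, ?_⟩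
    exact (hsum n hnm fun i => some (p i)).2.trans (min_le_left _ _)
  have hJ : ∀ n ≤ m, ∀ p : Fin n → R ⊕ S, (∃ i, ∃ j, p i = Sum.inr j) →
      ¬(n = m ∧ ∃ j, ∀ i, p i = Sum.inr j) →
      ‖(∏ i, (p i).elim 1 μ) *
        Φ (∑ i, (p i).elim (fun i => (t i * v' : ℂ)) fun j => (s j * v : ℂ))‖ < 1 := by
    rintro n hnm p ⟨i₀, j₀, h₀⟩ hex
    obtain ⟨hs1, hs2⟩ := hsum n hnm fun i => (p i).getLeft?
    set τ := ∑ i, ((p i).getLeft?).elim 0 t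
    have hy : dist ((τ : ℂ) * v') 0 < δ := by
      rw [dist_zero_right, norm_mul, Complex.norm_real, Real.norm_of_nonneg hs1]
      calc τ * ‖v'‖ ≤ δ / (2 * ‖v'‖) * ‖v'‖ := by
            gcongr
            exact hs2.trans (min_le_right _ _)
        _ = δ / 2 := by field_simp
        _ < δ := by linarith
    have key := hball hy n hnm (fun i => (p i).getRight?) ⟨i₀, by simp [h₀]⟩ (by
      rintro ⟨hnm', j, hj⟩
      exact hex ⟨hnm', j, fun i => Sum.getRight?_eq_some_iff.1 (hj i)⟩)
    have e1 : ∀ x : R ⊕ S, Option.elim x.getRight? (1 : ℂ) μ = Sum.elim (1 : R → ℂ) μ x := by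
      rintro (x | x) <;> rfl
    have e2 : (∑ i, (p i).elim (fun i => (t i * v' : ℂ)) fun j => (s j * v : ℂ)) =
        ((∑ i, ((p i).getRight?).elim 0 s : ℝ) : ℂ) * v + (τ : ℂ) * v' := by
      simp only [τ]
      push_cast
      rw [Finset.sum_mul, Finset.sum_mul, ← Finset.sum_add_distrib]
      refine Finset.sum_congr rfl fun i _ => ?_
      rcases p i with x | x <;> simp
    simp only [e1] at key
    rw [e2]
    exact key
  have hlim := fun n (hn : 1 ≤ n) (hnm : n ≤ m) =>
    hT.tendsto_iterate_pow_sum hΦ hm (fun x : R => α x) r hμ1 hI hJ hn hnm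
  set f : ℕ → entireFunctions := fun q => ∑ i : R, α i • entireExp (t i * v') +
    ∑ j, (r j * μ j ^ q) • entireExp (s j * v)
  have hfU : ∀ᶠ q in atTop, f q ∈ U := by
    have h1 : Tendsto f atTop (𝓝 (∑ i : R, α i • entireExp (t i * v') +
        ∑ j, (r j * 0 : ℂ) • entireExp (s j * v))) :=
      tendsto_const_nhds.add (tendsto_finsetSum _ fun j _ =>
        ((tendsto_pow_atTop_nhds_zero_of_norm_lt_one (hμlt j)).const_mul _).smul_const _)
    refine h1.eventually_mem (hU.mem_nhds ?_)
    rw [← Finset.sum_coe_sort] at hRU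
    simpa using hRU
  have hfV : ∀ᶠ q in atTop, (T ^ q) (f q ^ m) ∈ V := by
    refine (hlim m hm le_rfl).eventually_mem (hV.mem_nhds ?_)
    rw [← Finset.sum_coe_sort] at hSV
    simpa only [if_true, hr, hms] using hSV
  have hfW : ∀ᶠ q in atTop, ∀ j ∈ Finset.Ico 1 m, (T ^ q) (f q ^ j) ∈ W := by
    rw [Finset.eventually_all]
    intro j hj
    rw [Finset.mem_Ico] at hj
    have := hlim j hj.1 hj.2.le
    rw [if_neg hj.2.ne] at this
    exact this.eventually_mem hW
  obtain ⟨q, h1, h2, h3⟩ := (hfU.and (hfV.and hfW)).exists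
  exact ⟨f q, h1, q, h2, fun j hj hjm => h3 j (Finset.mem_Ico.2 ⟨hj, hjm⟩)⟩

/-- A convolution operator `Φ(D)` with `Φ(0) = 1` has a hypercyclic algebra as soon as
`(log Φ)''(0) ≠ 0`. -/
theorem IsSymbolOperator.hasHypercyclicAlgebra {Φ : ℂ → ℂ}
    {T : entireFunctions →L[ℂ] entireFunctions} (hT : IsSymbolOperator Φ T)
    (hΦ : Differentiable ℂ Φ) (hΦ0 : Φ 0 = 1)
    (h2 : deriv (deriv fun w => Complex.log (Φ w)) 0 ≠ 0) :
    HasHypercyclicAlgebra T := by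
  have hg : AnalyticAt ℂ (fun w => Complex.log (Φ w)) 0 :=
    (hΦ.analyticAt 0).clog (by simp [hΦ0])
  have h2' : deriv (deriv fun w => -Complex.log (Φ w)) 0 ≠ 0 := by
    have : (deriv fun w => -Complex.log (Φ w)) = fun w => -deriv (fun w => Complex.log (Φ w)) w :=
      funext fun w => deriv.fun_neg
    rw [this, deriv.fun_neg]
    exact neg_ne_zero.2 h2
  obtain ⟨v, hv, η, hη, hconv, hpos⟩ := exists_strictConvexOn_re hg h2 (by simp [hΦ0])
  obtain ⟨v', hv', η', hη', -, hneg⟩ := exists_strictConvexOn_re hg.fun_neg h2' (by simp [hΦ0])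
  simp only [Complex.log_re, Complex.neg_re, Left.neg_pos_iff] at hconv hpos hneg
  have hgt : ∀ s : ℝ, s ∈ Ioc 0 η → 1 < ‖Φ (s * v)‖ := fun s hs =>
    (Real.log_pos_iff (norm_nonneg _)).1 (hpos s hs)
  have hlt : ∀ s : ℝ, s ∈ Ioc 0 η' → ‖Φ (s * v')‖ < 1 := fun s hs => by
    by_contra h
    exact absurd (hneg s hs) (not_lt.2 (Real.log_nonneg (not_lt.1 h)))
  exact hasHypercyclicAlgebra_of_steering T fun m hm U V hU hUne hV hVne W hW =>
    hT.exists_steering hΦ hΦ0 hv hv' hη hη' hconv hgt hlt hm hU hUne hV hVne hW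

/-! ### The canonical product. -/

section CanonicalProduct

variable {z : ℕ → ℂ}

theorem summable_norm_neg_div (hsum : Summable fun n => 1 / ‖z n‖) (w : ℂ) :
    Summable fun n => ‖-(w / z n)‖ := by
  have := hsum.mul_left ‖w‖
  simpa [norm_div, div_eq_mul_inv] using this

theorem multipliable_one_sub_div (hsum : Summable fun n => 1 / ‖z n‖) (w : ℂ) :
    Multipliable fun n => 1 - w / z n := by
  simpa only [sub_eq_add_neg] using multipliable_one_add_of_summable (summable_norm_neg_div hsum w)

theorem multipliableLocallyUniformlyOn_one_sub_div (hsum : Summable fun n => 1 / ‖z n‖) (R : ℝ) :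
    MultipliableLocallyUniformlyOn (fun n w => 1 - w / z n) (Metric.ball (0 : ℂ) R) := by
  simp only [sub_eq_add_neg]
  refine (hsum.mul_left R).multipliableLocallyUniformlyOn_nat_one_add Metric.isOpen_ball
    (Eventually.of_forall fun n w hw => ?_) fun n => by fun_prop
  have hw' : ‖w‖ < R := by simpa using hw
  rw [norm_neg, norm_div, div_eq_mul_one_div]
  gcongr

theorem differentiable_tprod_one_sub_div (hsum : Summable fun n => 1 / ‖z n‖) :
    Differentiable ℂ fun w => ∏' n, (1 - w / z n) := by
  intro w
  have h := (multipliableLocallyUniformlyOn_one_sub_div hsum (‖w‖ + 1)).hasProdLocallyUniformlyOn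
  have hd : DifferentiableOn ℂ (fun w => ∏' n, (1 - w / z n)) (Metric.ball 0 (‖w‖ + 1)) :=
    TendstoLocallyUniformlyOn.differentiableOn h
      (Eventually.of_forall fun s => by fun_prop) Metric.isOpen_ball
  exact hd.differentiableAt (Metric.isOpen_ball.mem_nhds (by simp))

theorem norm_tprod_one_sub_div_le (hsum : Summable fun n => 1 / ‖z n‖) (w : ℂ) :
    ‖∏' n, (1 - w / z n)‖ ≤ Real.exp ((∑' n, 1 / ‖z n‖) * ‖w‖) := by
  refine le_of_tendsto (multipliable_one_sub_div hsum w).hasProd.norm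
    (Eventually.of_forall fun s => ?_)
  calc ∏ n ∈ s, ‖1 - w / z n‖ ≤ ∏ n ∈ s, Real.exp (1 / ‖z n‖ * ‖w‖) := by
        refine Finset.prod_le_prod (fun n _ => norm_nonneg _) fun n _ => ?_
        have h1 : ‖1 - w / z n‖ ≤ 1 + ‖w‖ / ‖z n‖ := by
          simpa [norm_div] using norm_sub_le (1 : ℂ) (w / z n)
        have h2 := Real.add_one_le_exp (1 / ‖z n‖ * ‖w‖)
        have h3 : 1 / ‖z n‖ * ‖w‖ = ‖w‖ / ‖z n‖ := by ring
        linarith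
    _ = Real.exp ((∑ n ∈ s, 1 / ‖z n‖) * ‖w‖) := by
        rw [← Real.exp_sum, Finset.sum_mul]
    _ ≤ _ := by
        gcongr
        exact hsum.sum_le_tsum s fun n _ => by positivity

/-- The logarithmic derivative turns the product into a sum, and the product is `1` at `0`. -/
theorem deriv_tprod_one_sub_div_zero (hsum : Summable fun n => 1 / ‖z n‖) :
    deriv (fun w => ∏' n, (1 - w / z n)) 0 = -∑' n, 1 / z n := by
  have hl : ∀ n, logDeriv (fun w => 1 - w / z n) 0 = -(1 / z n) := fun n => by
    have : HasDerivAt (fun w : ℂ => 1 - w / z n) (-(1 / z n)) 0 :=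
      ((hasDerivAt_id (0 : ℂ)).div_const (z n)).const_sub 1
    rw [logDeriv_apply, this.deriv]
    simp
  have hs : Summable fun n => 1 / z n := Summable.of_norm (by simpa using hsum)
  have h := logDeriv_tprod_eq_tsum (s := Metric.ball (0 : ℂ) 1) (x := 0) Metric.isOpen_ball
    (by simp) (f := fun n w => 1 - w / z n) (by simp) (fun n => by fun_prop)
    (by simpa only [hl] using hs.neg) (multipliableLocallyUniformlyOn_one_sub_div hsum 1) (by simp)
  simp only [hl, tsum_neg] at h
  rw [← h, logDeriv_apply]
  simp

end CanonicalProduct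

/-! ### Second logarithmic derivative and conclusion. -/

/-- If `Φ(w) Φ(-w) = Q(w²)`, then `(log Φ)''(0) = Q'(0)`. -/
theorem deriv_deriv_log_eq {Φ Q : ℂ → ℂ} (hΦ : Differentiable ℂ Φ) (hQ : Differentiable ℂ Q)
    (hΦ0 : Φ 0 = 1) (hΦQ : ∀ w, Φ w * Φ (-w) = Q (w ^ 2)) :
    deriv (deriv fun w => Complex.log (Φ w)) 0 = deriv Q 0 := by
  have hQ0 : Q 0 = 1 := by simpa [hΦ0] using (hΦQ 0).symm
  set ψ : ℂ → ℂ := fun w => deriv Φ w / Φ w with hψ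
  have hslit : ∀ᶠ w in 𝓝 (0 : ℂ), Φ w ∈ Complex.slitPlane :=
    hΦ.continuous.continuousAt.eventually_mem
      (Complex.isOpen_slitPlane.mem_nhds (by simp [hΦ0]))
  have hlog : (deriv fun w => Complex.log (Φ w)) =ᶠ[𝓝 0] ψ := by
    filter_upwards [hslit] with w hw
    exact ((hΦ w).hasDerivAt.clog hw).deriv
  rw [hlog.deriv_eq]
  have hψd : DifferentiableAt ℂ ψ 0 := (hΦ.deriv 0).div (hΦ 0) (by simp [hΦ0])
  -- Both sides are the logarithmic derivative of `Φ(w) Φ(-w) = Q(w²)`. Differentiating once more at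
  -- `0` gives `2 ψ'(0) = 2 Q'(0)`.
  have hsub : (fun w => ψ w - ψ (-w)) =ᶠ[𝓝 0]
      fun w => w * (2 * (deriv Q (w ^ 2) / Q (w ^ 2))) := by
    have hneg : ∀ᶠ w in 𝓝 (0 : ℂ), Φ (-w) ∈ Complex.slitPlane := by
      have : Tendsto (fun w : ℂ => -w) (𝓝 0) (𝓝 0) := by
        simpa using (continuous_neg (G := ℂ)).tendsto 0
      exact this.eventually hslit
    filter_upwards [hslit, hneg] with w h1 h2
    have h1' := Complex.slitPlane_ne_zero h1
    have h2' := Complex.slitPlane_ne_zero h2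
    have hL : HasDerivAt (fun w => Φ w * Φ (-w))
        (deriv Φ w * Φ (-w) + Φ w * (deriv Φ (-w) * -1)) w :=
      (hΦ w).hasDerivAt.mul ((hΦ (-w)).hasDerivAt.comp w (hasDerivAt_neg w))
    have hR : HasDerivAt (fun w => Q (w ^ 2)) (deriv Q (w ^ 2) * (2 * w)) w := by
      have h2 : HasDerivAt (fun w : ℂ => w ^ 2) (2 * w) w := by simpa using hasDerivAt_pow 2 w
      exact (hQ (w ^ 2)).hasDerivAt.comp w h2
    rw [funext hΦQ] at hL
    have hd := hL.unique hR
    simp only [hψ]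
    rw [← hΦQ]
    field_simp
    linear_combination hd
  have e1 : HasDerivAt (fun w => ψ w - ψ (-w)) (deriv ψ 0 - deriv ψ 0 * -1) 0 := by
    refine hψd.hasDerivAt.sub ?_
    have : HasDerivAt ψ (deriv ψ 0) (-0) := by simpa using hψd.hasDerivAt
    exact this.comp 0 (hasDerivAt_neg 0)
  have hk : DifferentiableAt ℂ (fun w => 2 * (deriv Q (w ^ 2) / Q (w ^ 2))) 0 := by
    have h1 : DifferentiableAt ℂ (fun w => deriv Q (w ^ 2)) 0 :=
      (hQ.deriv.comp (differentiable_id.pow 2)) 0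
    have h2 : DifferentiableAt ℂ (fun w => Q (w ^ 2)) 0 := (hQ.comp (differentiable_id.pow 2)) 0
    exact (h1.div h2 (by simp [hQ0])).const_mul 2
  have e2 := (hasDerivAt_id (0 : ℂ)).mul hk.hasDerivAt
  have e3 := e1.unique (e2.congr_of_eventuallyEq hsub)
  simp [hQ0] at e3
  linear_combination e3 / 2

theorem corollary3p5 (a : ℂ) (z : ℕ → ℂ) (Φ : ℂ → ℂ)
    (ha : a ≠ 0) (hz : ∀ n, z n ≠ 0)
    (hsum : Summable fun n => 1 / ‖z n‖)
    (hsq : ∑' n, 1 / z n ^ 2 ≠ 0)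
    (hΦ : ∀ w, Φ w = Complex.exp (a * w) * ∏' n, (1 - w / z n)) :
    Differentiable ℂ Φ ∧
      ∃ T : entireFunctions →L[ℂ] entireFunctions,
        IsSymbolOperator Φ T ∧ HasHypercyclicAlgebra T := by
  have hd : Differentiable ℂ Φ := by
    rw [funext hΦ]
    have := differentiable_tprod_one_sub_div hsum
    fun_prop
  have hsum2 : Summable fun n => 1 / ‖z n ^ 2‖ := by
    refine Summable.of_norm_bounded_eventually_nat (g := fun n => 1 / ‖z n‖) hsum ?_
    filter_upwards [hsum.tendsto_atTop_zero.eventually_lt_const one_pos] with n hn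
    have h0 : 0 ≤ 1 / ‖z n‖ := by positivity
    rw [Real.norm_of_nonneg (by positivity), norm_pow, ← one_div_pow, sq]
    exact mul_le_of_le_one_left h0 hn.le
  have hΦ0 : Φ 0 = 1 := by simp [hΦ]
  -- Symmetrising cancels `exp (a * w)` and leaves a product of the same type in `w ^ 2`, with zeros
  -- `z n ^ 2`.
  have hΦQ : ∀ w, Φ w * Φ (-w) = ∏' n, (1 - w ^ 2 / z n ^ 2) := fun w => by
    have hexp : Complex.exp (a * w) * Complex.exp (a * -w) = 1 := by
      rw [← Complex.exp_add]
      simp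
    rw [hΦ, hΦ, mul_mul_mul_comm, hexp, one_mul,
      ← (multipliable_one_sub_div hsum w).tprod_mul (multipliable_one_sub_div hsum (-w))]
    refine tprod_congr fun n => ?_
    ring
  obtain ⟨T, hT⟩ := exists_isSymbolOperator hd (C := ‖a‖ + ∑' n, 1 / ‖z n‖) fun w => by
    rw [hΦ, norm_mul, add_mul, Real.exp_add]
    gcongr
    · rw [Complex.norm_exp, ← norm_mul]
      exact Real.exp_le_exp.2 (Complex.re_le_norm _)
    · exact norm_tprod_one_sub_div_le hsum w
  refine ⟨hd, T, hT, hT.hasHypercyclicAlgebra hd hΦ0 ?_⟩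
  rw [deriv_deriv_log_eq hd (differentiable_tprod_one_sub_div hsum2) hΦ0 hΦQ,
    deriv_tprod_one_sub_div_zero hsum2]
  exact neg_ne_zero.2 hsq
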